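/- **Definitions.** "Directed colimit" means colimit of a small diagram indexed by a nonempty directed poset. Let $\Sigma$ be a finitary, possibly many-sorted, signature. $\mathrm{Emb}(\Sigma)$ is the category of $\Sigma$-structures and substructure embeddings (injective homomorphisms that reflect all relations), and $|A|$ is the cardinality of the disjoint union of the carriers of $A$. A functor $H:\mathcal K\to\mathcal L$ is *full with respect to isomorphisms* if every isomorphism $f:HA\to HB$ is $H(\bar f)$ for some isomorphism $\bar f:A\to B$. It is *nearly full* if, whenever $h:A\to C$ and $g:B\to C$ are morphisms of $\mathcal K$ and $f:HA\to HB$ satisfies $H(g)\circ f=H(h)$, there is $\bar f:A\to B$ with $H(\bar f)=f$. A subcategory is nearly full if its inclusion functor is. An *abstract elementary class* is a nearly full (not necessarily full) subcategory $\mathcal K$ of $\mathrm{Emb}(\Sigma)$, for some finitary signature $\Sigma$, such that * $\mathcal K$ is closed under directed colimits in $\mathrm{Emb}(\Sigma)$: every colimit cocone in $\mathrm{Emb}(\Sigma)$ of a directed diagram in $\mathcal K$ lies in $\mathcal K$ and is a colimit cocone in $\mathcal K$; * there is a cardinal $\lambda$ such that for every morphism $f:A\to B$ of $\mathrm{Emb}(\Sigma)$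 with $B\in\mathcal K$ there is $h:A'\to B$ in $\mathcal K$ such that $f$ factorizes through $h$ in $\mathrm{Emb}(\Sigma)$ and $|A'|\le|A|+\lambda$. **Statement.** For a category $\mathcal K$ the following are equivalent: 1. $\mathcal K$ is equivalent to an abstract elementary class. 2. $\mathcal K$ is an accessible category with directed colimits, all of its morphisms are monomorphisms, and there are a finitely accessible category $\mathcal L$ and an embedding (a faithful functor injective on objects) $H:\mathcal K\to\mathcal L$ that is full with respect to isomorphisms, nearly full, and preserves directed colimits and monomorphisms. 3. The same as 2, with $H$ only required to be faithful instead of an embedding. -/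

import Mathlib

universe w v u v₁ u₁ v₂ u₂

open CategoryTheory CategoryTheory.Limits

namespace AEC

/-! ### Finitary many-sorted signatures and the category of structures and embeddings -/

/-- A finitary many-sorted signature: a set of sorts, a set of operation symbols
`f : s₁ × ⋯ × sₙ → s` and a set of relation symbols `R ⊆ s₁ × ⋯ × sₙ`. -/
structure Signature where
  Sorts : Type w
  Ops : Type w
  opArity : Ops → ℕ
  opDom : (f : Ops) → Fin (opArity f) → Sorts
  opCod : Ops → Sorts
  Rels : Type w
  relArity : Rels → ℕ
  relDom : (R : Rels) → Fin (relArity R) → Sorts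

/-- A structure for the signature `Sg`. Carriers may be empty.
These are the objects of the category `Emb(Sg)`. -/
structure Emb (Sg : Signature.{w}) where
  carrier : Sg.Sorts → Type w
  op : (f : Sg.Ops) → ((i : Fin (Sg.opArity f)) → carrier (Sg.opDom f i)) → carrier (Sg.opCod f)
  rel : (R : Sg.Rels) → ((i : Fin (Sg.relArity R)) → carrier (Sg.relDom R i)) → Prop

namespace Emb

variable {Sg : Signature.{w}}

/-- The cardinality of the underlying set (the disjoint union of all the carriers). -/
def card (A : Emb Sg) : Cardinal.{w} := Cardinal.mk (Σ s, A.carrier s)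

/-- A substructure embedding: a homomorphism that is injective and reflects all relations. -/
@[ext]
structure Hom (A B : Emb Sg) where
  toFun : (s : Sg.Sorts) → A.carrier s → B.carrier s
  injective : ∀ s, Function.Injective (toFun s)
  map_op : ∀ (f : Sg.Ops) (x : (i : Fin (Sg.opArity f)) → A.carrier (Sg.opDom f i)),
    toFun (Sg.opCod f) (A.op f x) = B.op f (fun i => toFun (Sg.opDom f i) (x i))
  map_rel : ∀ (R : Sg.Rels) (x : (i : Fin (Sg.relArity R)) → A.carrier (Sg.relDom R i)),
    B.rel R (fun i => toFun (Sg.relDom R i) (x i)) ↔ A.rel R x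

instance : Category (Emb Sg) where
  Hom := Hom
  id A :=
    { toFun := fun _ a => a
      injective := fun _ _ _ h => h
      map_op := fun _ _ => rfl
      map_rel := fun _ _ => Iff.rfl }
  comp f g :=
    { toFun := fun s a => g.toFun s (f.toFun s a)
      injective := fun s => (g.injective s).comp (f.injective s)
      map_op := fun o x => by rw [f.map_op, g.map_op]
      map_rel := fun R x => (g.map_rel R _).trans (f.map_rel R x) }

end Emb

/-! ### Properties of functors -/

section Functors

variable {C : Type u₁} [Category.{v₁} C] {D : Type u₂} [Category.{v₂} D]

/-- `H` is full with respect to isomorphisms. -/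
def FullOnIsos (H : C ⥤ D) : Prop :=
  ∀ (A B : C) (f : H.obj A ≅ H.obj B), ∃ f' : A ≅ B, H.mapIso f' = f

/-- `H` is nearly full: in every commutative triangle `f ≫ H g = H h`,
the morphism `f : H A ⟶ H B` is in the image of `H`. -/
def NearlyFull (H : C ⥤ D) : Prop :=
  ∀ (A B E : C) (h : A ⟶ E) (g : B ⟶ E) (f : H.obj A ⟶ H.obj B),
    f ≫ H.map g = H.map h → ∃ f' : A ⟶ B, H.map f' = f

/-- `C` has colimits of all diagrams indexed by (nonempty) directed posets in the universe `w`. -/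
def HasDirectedColimits (C : Type u₁) [Category.{v₁} C] : Prop :=
  ∀ (I : Type w) [PartialOrder I] [IsDirectedOrder I] [Nonempty I], HasColimitsOfShape I C

/-- `H` preserves colimits of diagrams indexed by (nonempty) directed posets in
the universe `w`. -/
def PreservesDirectedColimits (H : C ⥤ D) : Prop :=
  ∀ (I : Type w) [PartialOrder I] [IsDirectedOrder I] [Nonempty I], PreservesColimitsOfShape I H

end Functors

/-! ### Subcategories (not necessarily full) -/

/-- A subcategory of `C`: a class of objects and a class of morphisms between them,
containing identities and closed under composition. -/
structure Subcat (C : Type u) [Category.{v} C] where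
  obj : C → Prop
  hom : ∀ {X Y : C}, (X ⟶ Y) → Prop
  source_mem : ∀ {X Y : C} {f : X ⟶ Y}, hom f → obj X
  target_mem : ∀ {X Y : C} {f : X ⟶ Y}, hom f → obj Y
  id_mem : ∀ {X : C}, obj X → hom (𝟙 X)
  comp_mem : ∀ {X Y Z : C} {f : X ⟶ Y} {g : Y ⟶ Z}, hom f → hom g → hom (f ≫ g)

namespace Subcat

variable {C : Type u} [Category.{v} C] (S : Subcat C)

/-- The objects of a subcategory, as a type. -/
structure Obj where
  val : C
  property : S.obj val

instance : Category S.Obj where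
  Hom X Y := { f : X.val ⟶ Y.val // S.hom f }
  id X := ⟨𝟙 X.val, S.id_mem X.property⟩
  comp f g := ⟨f.1 ≫ g.1, S.comp_mem f.2 g.2⟩

/-- The inclusion functor of a subcategory. -/
def incl : S.Obj ⥤ C where
  obj X := X.val
  map f := f.1

/-- The subcategory `S` is closed in `C` under directed colimits: whenever `c` is a colimit
cocone in `C` of a directed diagram in `S`, then `c` lies in `S` (both its vertex and its legs)
and it is a colimit cocone in `S`, i.e. the morphisms out of `c` induced by cocones in `S`
are in `S`. -/
def ClosedUnderDirectedColimits : Prop :=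
  ∀ (I : Type w) [PartialOrder I] [IsDirectedOrder I] [Nonempty I]
    (D : I ⥤ S.Obj) (c : Cocone (D ⋙ S.incl)) (hc : IsColimit c),
    S.obj c.pt ∧ (∀ i, S.hom (c.ι.app i)) ∧
      ∀ s : Cocone D, S.hom (hc.desc (S.incl.mapCocone s))

end Subcat

/-! ### Abstract elementary classes -/

/-- The subcategory `S` of `Emb(Sg)` is an abstract elementary class. -/
structure IsAEC {Sg : Signature.{w}} (S : Subcat (Emb Sg)) : Prop where
  nearlyFull : NearlyFull S.incl
  closed : Subcat.ClosedUnderDirectedColimits.{w} S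
  lowenheimSkolem : ∃ lam : Cardinal.{w}, ∀ (A B : Emb Sg) (f : A ⟶ B), S.obj B →
    ∃ (A' : Emb Sg) (h : A' ⟶ B) (k : A ⟶ A'), S.hom h ∧ k ≫ h = f ∧ A'.card ≤ A.card + lam

/-- `K` is equivalent to an abstract elementary class. -/
def EquivalentToAEC (K : Type u) [Category.{v} K] : Prop :=
  ∃ (Sg : Signature.{w}) (S : Subcat (Emb Sg)), IsAEC S ∧ Nonempty (K ≌ S.Obj)

end AEC

/-! Both directions pass through a functor `U : C ⥤ Emb Sg` that is faithful, full on isomorphisms,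
nearly full and preserves directed colimits (`IsPresentation`). Two facts make such functors
tractable. A filtered cocone in `Emb Sg` is a colimit exactly when its legs are jointly surjective,
and presentations transfer this test to `C`. An embedding factors through another as soon as its
image is contained in the other's image, and near fullness transfers this to `C` too.

From an abstract elementary class: the Löwenheim–Skolem axiom places any fewer than `κ` elements of
an object, for a suitable `κ`, in a subobject generated by fewer than `κ` elements. These subobjects
are `κ`-presentable and form a `κ`-directed diagram with the object as colimit, which gives
accessibility (`IsPresentation.isCardinalAccessibleCategory`). The same criterion with `κ = ℵ₀`
shows that `Emb Sg` is finitely accessible, so it serves as the target. Adding a copy of each object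
of `K` to the target makes the functor injective on objects.

Conversely, the finitely presentable objects of `L` are dense, so `X ↦ Hom(F -, H X)` presents `K`
by presheaves, viewed as structures with unary operations (`isPresentation_nerveFunctor`). The
replete image of a presentation of an accessible category is an abstract elementary class
(`isAEC_image`); its Löwenheim–Skolem bound comes from colimits indexed by the finite subsets of a
given set of elements (`exists_card_le`). -/

namespace AEC

/-! ### Structures and their embeddings. -/

namespace Emb

variable {Sg : Signature.{w}}

/-- The underlying set of a structure, the disjoint union of its carriers. -/
abbrev Elem (A : Emb Sg) : Type w := Σ s, A.carrier s

/-- The function underlying an embedding. -/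
def ap {A B : Emb Sg} (f : A ⟶ B) (s : Sg.Sorts) (a : A.carrier s) : B.carrier s :=
  Hom.toFun f s a

@[simp]
lemma ap_id (A : Emb Sg) (s : Sg.Sorts) (a : A.carrier s) : ap (𝟙 A) s a = a := rfl

@[simp]
lemma ap_comp {A B C : Emb Sg} (f : A ⟶ B) (g : B ⟶ C) (s : Sg.Sorts) (a : A.carrier s) :
    ap (f ≫ g) s a = ap g s (ap f s a) := rfl

lemma hom_ext {A B : Emb Sg} {f g : A ⟶ B} (h : ∀ s a, ap f s a = ap g s a) : f = g :=
  Hom.ext (funext fun s => funext fun a => h s a)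

lemma ap_injective {A B : Emb Sg} (f : A ⟶ B) (s : Sg.Sorts) : Function.Injective (ap f s) :=
  Hom.injective f s

lemma ap_op {A B : Emb Sg} (f : A ⟶ B) (o : Sg.Ops)
    (x : (i : Fin (Sg.opArity o)) → A.carrier (Sg.opDom o i)) :
    ap f _ (A.op o x) = B.op o (fun i => ap f _ (x i)) :=
  Hom.map_op f o x

lemma ap_rel {A B : Emb Sg} (f : A ⟶ B) (R : Sg.Rels)
    (x : (i : Fin (Sg.relArity R)) → A.carrier (Sg.relDom R i)) :
    B.rel R (fun i => ap f _ (x i)) ↔ A.rel R x :=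
  Hom.map_rel f R x

instance mono {A B : Emb Sg} (f : A ⟶ B) : Mono f where
  right_cancellation g h e := hom_ext fun s a => ap_injective f s (by
    rw [← ap_comp, ← ap_comp, e])

/-- The image of an embedding, as a set of elements. -/
def range {A B : Emb Sg} (f : A ⟶ B) : Set B.Elem := {x | ∃ a, ap f x.1 a = x.2}

lemma mk_mem_range_iff {A B : Emb Sg} (f : A ⟶ B) {s : Sg.Sorts} {b : B.carrier s} :
    (⟨s, b⟩ : B.Elem) ∈ range f ↔ ∃ a, ap f s a = b := Iff.rfl

lemma ap_mem_range {A B : Emb Sg} (f : A ⟶ B) {s : Sg.Sorts} (a : A.carrier s) :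
    (⟨s, ap f s a⟩ : B.Elem) ∈ range f := ⟨a, rfl⟩

lemma range_comp_subset {A B C : Emb Sg} (f : A ⟶ B) (g : B ⟶ C) : range (f ≫ g) ⊆ range g := by
  rintro ⟨s, x⟩ ⟨a, ha⟩
  exact ⟨ap f s a, ha⟩

/-- The map on underlying sets induced by an embedding. -/
def elemMap {A B : Emb Sg} (f : A ⟶ B) (x : A.Elem) : B.Elem := ⟨x.1, ap f x.1 x.2⟩

lemma elemMap_injective {A B : Emb Sg} (f : A ⟶ B) : Function.Injective (elemMap f) := by
  rintro ⟨s, a⟩ ⟨t, b⟩ h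
  obtain rfl : s = t := congrArg Sigma.fst h
  exact congrArg _ (ap_injective f s (eq_of_heq (Sigma.mk.inj_iff.1 h).2))

/-- An embedding whose image is contained in that of `h` factors through `h`. -/
lemma exists_lift {A A' B : Emb Sg} (f : A ⟶ B) (h : A' ⟶ B) (hr : range f ⊆ range h) :
    ∃ k : A ⟶ A', k ≫ h = f := by
  have hr' (s : Sg.Sorts) (a : A.carrier s) : ∃ a', ap h s a' = ap f s a := hr (ap_mem_range f a)
  choose k hk using hr'
  let k' : A ⟶ A' :=
    { toFun := k
      injective := fun s a b e => ap_injective f s (by rw [← hk, ← hk, e])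
      map_op := fun o x => ap_injective h _ (by
        rw [hk, ap_op, ap_op]
        simp only [hk])
      map_rel := fun R x => by
        rw [← ap_rel h, ← ap_rel f]
        simp only [hk] }
  exact ⟨k', hom_ext hk⟩

/-- Transport of a structure along bijections of the carriers. -/
def transport (A : Emb Sg) {c : Sg.Sorts → Type w} (e : ∀ s, A.carrier s ≃ c s) : Emb Sg where
  carrier := c
  op f x := e _ (A.op f (fun i => (e _).symm (x i)))
  rel R x := A.rel R (fun i => (e _).symm (x i))

/-- The transported structure is isomorphic to the original one. -/
def transportIso (A : Emb Sg) {c : Sg.Sorts → Type w} (e : ∀ s, A.carrier s ≃ c s) :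
    A ≅ A.transport e where
  hom :=
    { toFun := fun s => e s
      injective := fun s => (e s).injective
      map_op := fun o x => by simp [transport]
      map_rel := fun R x => by simp [transport] }
  inv :=
    { toFun := fun s => (e s).symm
      injective := fun s => (e s).symm.injective
      map_op := fun o x => by simp [transport]
      map_rel := fun R x => by simp [transport] }
  hom_inv_id := hom_ext fun s a => (e s).symm_apply_apply a
  inv_hom_id := hom_ext fun s a => (e s).apply_symm_apply a

/-! ### Filtered colimits of structures -/

section Colimits

variable {J : Type v₁} [Category.{u₁} J] {F : J ⥤ Emb Sg}

/-- A cocone is jointly surjective if every element of its vertex is in the image of a leg. -/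
def JointlySurjective (c : Cocone F) : Prop :=
  ∀ x : c.pt.Elem, ∃ j, x ∈ range (B := c.pt) (c.ι.app j)

lemma ap_ι_map (c : Cocone F) {j k : J} (u : j ⟶ k) (s : Sg.Sorts) (a : (F.obj j).carrier s) :
    ap (B := c.pt) (c.ι.app k) s (ap (F.map u) s a) = ap (B := c.pt) (c.ι.app j) s a := by
  rw [← ap_comp, c.w]

lemma range_ι_subset (c : Cocone F) {j k : J} (u : j ⟶ k) :
    range (B := c.pt) (c.ι.app j) ⊆ range (B := c.pt) (c.ι.app k) := by
  rintro ⟨s, _⟩ ⟨a, ha⟩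
  exact ⟨ap (F.map u) s a, (ap_ι_map c u s a).trans ha⟩

/-- Fewer than `κ` elements of the vertex of a jointly surjective `κ`-filtered cocone
are all in the image of a single leg. -/
lemma JointlySurjective.exists_forall_mem {c : Cocone F} (hc : JointlySurjective c)
    (κ : Cardinal.{w}) [Fact κ.IsRegular] [IsCardinalFiltered J κ] {T : Type v₂}
    (hT : HasCardinalLT T κ) (x : T → c.pt.Elem) :
    ∃ j, ∀ t, x t ∈ range (B := c.pt) (c.ι.app j) := by
  choose j hj using fun t => hc (x t)
  exact ⟨IsCardinalFiltered.max j hT, fun t =>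
    range_ι_subset c (IsCardinalFiltered.toMax j hT t) (hj t)⟩

attribute [local instance] Cardinal.fact_isRegular_aleph0 in
lemma JointlySurjective.exists_lift_fin [IsFiltered J] {c : Cocone F} (hc : JointlySurjective c)
    {n : ℕ} {dom : Fin n → Sg.Sorts} (x : ∀ i, c.pt.carrier (dom i)) :
    ∃ (j : J) (y : ∀ i, (F.obj j).carrier (dom i)),
      x = fun i => ap (B := c.pt) (c.ι.app j) _ (y i) := by
  have := (isCardinalFiltered_aleph0_iff.{w} J).2 inferInstance
  obtain ⟨j, hj⟩ := hc.exists_forall_mem Cardinal.aleph0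
    (hasCardinalLT_of_finite (Fin n) _ le_rfl) (fun i => ⟨dom i, x i⟩)
  choose y hy using hj
  exact ⟨j, y, funext fun i => (hy i).symm⟩

/-- All legs are injective, so two elements agree in the vertex exactly when they agree at a common
later stage, a condition that does not involve the cocone. -/
lemma ap_ι_eq_of_eq [IsFiltered J] (c s : Cocone F) {j k : J} {t : Sg.Sorts}
    (a : (F.obj j).carrier t) (b : (F.obj k).carrier t)
    (h : ap (B := c.pt) (c.ι.app j) t a = ap (B := c.pt) (c.ι.app k) t b) :
    ap (B := s.pt) (s.ι.app j) t a = ap (B := s.pt) (s.ι.app k) t b := by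
  rw [← ap_ι_map c (IsFiltered.leftToMax j k), ← ap_ι_map c (IsFiltered.rightToMax j k)] at h
  rw [← ap_ι_map s (IsFiltered.leftToMax j k), ← ap_ι_map s (IsFiltered.rightToMax j k),
    ap_injective _ _ h]

/-- A jointly surjective filtered cocone is a colimit cocone. -/
lemma JointlySurjective.nonempty_isColimit [IsFiltered J] {c : Cocone F}
    (hc : JointlySurjective c) : Nonempty (IsColimit c) := by
  have hc' (t : Sg.Sorts) (x : c.pt.carrier t) :
      ∃ (j : J) (a : (F.obj j).carrier t), ap (B := c.pt) (c.ι.app j) t a = x := hc ⟨t, x⟩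
  choose j a ha using hc'
  let d (s : Cocone F) (t : Sg.Sorts) (x : c.pt.carrier t) : s.pt.carrier t :=
    ap (B := s.pt) (s.ι.app (j t x)) t (a t x)
  have hd (s : Cocone F) (i : J) (t : Sg.Sorts) (y : (F.obj i).carrier t) :
      d s t (ap (B := c.pt) (c.ι.app i) t y) = ap (B := s.pt) (s.ι.app i) t y :=
    ap_ι_eq_of_eq c s _ _ (ha t _)
  let desc (s : Cocone F) : c.pt ⟶ s.pt :=
    { toFun := d s
      injective := fun t x y h => by
        rw [← ha t x, ← ha t y]
        exact ap_ι_eq_of_eq s c _ _ h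
      map_op := fun o x => by
        obtain ⟨i, y, rfl⟩ := hc.exists_lift_fin x
        rw [← ap_op, hd, ap_op]
        simp only [hd]
      map_rel := fun R x => by
        obtain ⟨i, y, rfl⟩ := hc.exists_lift_fin x
        simp only [hd]
        rw [ap_rel, ap_rel] }
  exact ⟨{
    desc := desc
    fac := fun s i => hom_ext fun t y => hd s i t y
    uniq := fun s m hm => hom_ext fun t x => by
      change _ = d s t x
      rw [← ha t x, hd]
      rw [← hm]
      rfl }⟩

end Colimits

/-- The functor sending a structure to its carrier of a given sort. -/
def carrierFunctor (s : Sg.Sorts) : Emb Sg ⥤ Type w where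
  obj A := A.carrier s
  map f := TypeCat.ofHom (ap f s)

section Existence

variable {J : Type w} [SmallCategory J] [IsFiltered J] (F : J ⥤ Emb Sg)

/-- Every filtered diagram of structures has a jointly surjective cocone. -/
lemma exists_jointlySurjective : ∃ c : Cocone F, JointlySurjective c := by
  let X (s : Sg.Sorts) : Type w := colimit (F ⋙ carrierFunctor s)
  let ι (j : J) (s : Sg.Sorts) (a : (F.obj j).carrier s) : X s :=
    colimit.ι (F ⋙ carrierFunctor s) j a
  have hι {j k : J} (u : j ⟶ k) (s : Sg.Sorts) (a : (F.obj j).carrier s) :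
      ι k s (ap (F.map u) s a) = ι j s a :=
    ConcreteCategory.congr_hom (colimit.w (F ⋙ carrierFunctor s) u) a
  have surj (s : Sg.Sorts) (x : X s) : ∃ j a, ι j s a = x :=
    Types.jointly_surjective_of_isColimit (colimit.isColimit (F ⋙ carrierFunctor s)) x
  -- Elements identified in the colimit of sets are already identified by some transition map, and
  -- that map is injective.
  have inj (j : J) (s : Sg.Sorts) : Function.Injective (ι j s) := fun a b h => by
    obtain ⟨k, u, hu⟩ := (Types.FilteredColimit.isColimit_eq_iff'
      (colimit.isColimit (F ⋙ carrierFunctor s)) a b).1 h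
    exact ap_injective (F.map u) s hu
  have lift {n : ℕ} {dom : Fin n → Sg.Sorts} (x : ∀ i, X (dom i)) :
      ∃ (j : J) (y : ∀ i, (F.obj j).carrier (dom i)), (fun i => ι j _ (y i)) = x := by
    choose j y hy using fun i => surj _ (x i)
    classical
    obtain ⟨k, hk⟩ := IsFiltered.sup_objs_exists (Finset.univ.image j)
    let u (i : Fin n) : j i ⟶ k := (hk (Finset.mem_image_of_mem j (Finset.mem_univ i))).some
    exact ⟨k, fun i => ap (F.map (u i)) _ (y i), funext fun i => by rw [hι, hy]⟩
  have eq {n : ℕ} {dom : Fin n → Sg.Sorts} {j k : J} (x : ∀ i, (F.obj j).carrier (dom i))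
      (y : ∀ i, (F.obj k).carrier (dom i)) (h : (fun i => ι j _ (x i)) = fun i => ι k _ (y i)) :
      (fun i => ap (F.map (IsFiltered.leftToMax j k)) _ (x i)) =
        fun i => ap (F.map (IsFiltered.rightToMax j k)) _ (y i) := by
    funext i
    apply inj
    rw [hι, hι]
    exact congrFun h i
  -- Operations and relations on the colimit are read off at chosen representatives; `eq` shows that
  -- any two choices agree at a common stage.
  choose l y hy using @lift
  let A : Emb Sg :=
    { carrier := X
      op := fun o x => ι (l x) _ ((F.obj (l x)).op o (y x))
      rel := fun R x => (F.obj (l x)).rel R (y x) }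
  let leg (j : J) : F.obj j ⟶ A :=
    { toFun := ι j
      injective := inj j
      map_op := fun o x => by
        change _ = ι _ _ _
        have e := eq _ _ (hy fun i => ι j _ (x i))
        rw [← hι (IsFiltered.rightToMax (l fun i => ι j _ (x i)) j),
          ← hι (IsFiltered.leftToMax (l fun i => ι j _ (x i)) j) _
            ((F.obj _).op o (y fun i => ι j _ (x i))), ap_op, ap_op, e]
      map_rel := fun R x => by
        change (F.obj _).rel R _ ↔ _
        have e := eq _ _ (hy fun i => ι j _ (x i))
        rw [← ap_rel (F.map (IsFiltered.rightToMax (l fun i => ι j _ (x i)) j)),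
          ← ap_rel (F.map (IsFiltered.leftToMax (l fun i => ι j _ (x i)) j)), e] }
  refine ⟨{ pt := A, ι := { app := leg, naturality := fun j k u => ?_ } }, fun x => ?_⟩
  · exact hom_ext fun s a => hι u s a
  · obtain ⟨j, a, ha⟩ := surj x.1 x.2
    exact ⟨j, a, ha⟩

-- The comparison with a jointly surjective cocone is an embedding, hence injective, so preimages
-- found for the latter already work in the given colimit.
variable {F} in
lemma jointlySurjective_of_isColimit {c : Cocone F} (hc : IsColimit c) : JointlySurjective c := by
  obtain ⟨d, hd⟩ := exists_jointlySurjective F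
  rintro ⟨s, x⟩
  obtain ⟨j, hj⟩ := hd ⟨s, ap (hc.desc d) s x⟩
  obtain ⟨a, ha⟩ := (mk_mem_range_iff _).1 hj
  refine ⟨j, (mk_mem_range_iff _).2 ⟨a, ap_injective (hc.desc d) s ?_⟩⟩
  rw [← ap_comp, hc.fac]
  exact ha

instance hasColimitsOfShape : HasColimitsOfShape J (Emb Sg) where
  has_colimit F := by
    obtain ⟨c, hc⟩ := exists_jointlySurjective F
    obtain ⟨h⟩ := hc.nonempty_isColimit
    exact ⟨⟨c, h⟩⟩

end Existence

lemma hasDirectedColimits : HasDirectedColimits.{w} (Emb Sg) := fun _ _ _ _ => inferInstance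

/-! ### Generation of structures -/

/-- Membership in the substructure generated by a set of elements. -/
inductive InClosure (A : Emb Sg) (T : Set A.Elem) : (s : Sg.Sorts) → A.carrier s → Prop
  | base {s : Sg.Sorts} {a : A.carrier s} (h : (⟨s, a⟩ : A.Elem) ∈ T) : InClosure A T s a
  | op (o : Sg.Ops) (x : (i : Fin (Sg.opArity o)) → A.carrier (Sg.opDom o i))
      (h : ∀ i, InClosure A T _ (x i)) : InClosure A T _ (A.op o x)

/-- The set `T` generates the structure `A`. -/
def Generates (A : Emb Sg) (T : Set A.Elem) : Prop := ∀ s a, InClosure A T s a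

lemma generates_univ (A : Emb Sg) : Generates A Set.univ := fun _ _ => .base trivial

lemma InClosure.mem_range {A A' B : Emb Sg} {T : Set A.Elem} (g : A ⟶ B) (h : A' ⟶ B)
    (hT : ∀ x ∈ T, elemMap g x ∈ range h) {s : Sg.Sorts} {a : A.carrier s}
    (ha : InClosure A T s a) : (⟨s, ap g s a⟩ : B.Elem) ∈ range h := by
  induction ha with
  | base ha => exact hT _ ha
  | op o x _ ih =>
    choose y hy using ih
    exact ⟨A'.op o y, (ap_op h o y).trans
      ((congrArg (B.op o) (funext hy)).trans (ap_op g o x).symm)⟩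

lemma Generates.range_subset {A A' B : Emb Sg} {T : Set A.Elem} (hA : Generates A T) (g : A ⟶ B)
    (h : A' ⟶ B) (hT : ∀ x ∈ T, elemMap g x ∈ range h) : range g ⊆ range h := by
  rintro ⟨s, b⟩ hb
  obtain ⟨a, rfl⟩ := (mk_mem_range_iff g).1 hb
  exact (hA s a).mem_range g h hT

/-- The substructure generated by a set of elements. -/
def closure (A : Emb Sg) (T : Set A.Elem) : Emb Sg where
  carrier s := {a : A.carrier s // InClosure A T s a}
  op o x := ⟨A.op o fun i => (x i).1, .op o _ fun i => (x i).2⟩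
  rel R x := A.rel R fun i => (x i).1

/-- The inclusion of the substructure generated by a set of elements. -/
def closureι (A : Emb Sg) (T : Set A.Elem) : A.closure T ⟶ A where
  toFun _ a := a.1
  injective _ := Subtype.val_injective
  map_op _ _ := rfl
  map_rel _ _ := Iff.rfl

lemma subset_range_closureι (A : Emb Sg) (T : Set A.Elem) : T ⊆ range (A.closureι T) :=
  fun x hx => ⟨⟨x.2, .base hx⟩, rfl⟩

lemma generates_closure (A : Emb Sg) (T : Set A.Elem) :
    Generates (A.closure T) (elemMap (A.closureι T) ⁻¹' T) := by
  rintro s ⟨a, ha⟩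
  induction ha with
  | base h => exact .base h
  | op o x h ih => exact InClosure.op (A := A.closure T) o (fun i => ⟨x i, h i⟩) ih

lemma mk_preimage_elemMap_le {A B : Emb Sg} (f : A ⟶ B) (T : Set B.Elem) :
    Cardinal.mk (elemMap f ⁻¹' T) ≤ Cardinal.mk T :=
  Cardinal.mk_preimage_of_injective _ _ (elemMap_injective f)

section Cardinality

variable (A : Emb Sg) (T : Set A.Elem)

/-- The arities of the terms over `T`. -/
abbrev TermArity : (T ⊕ Sg.Ops) → Type
  | .inl _ => Empty
  | .inr o => Fin (Sg.opArity o)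

instance : ∀ a, Finite (TermArity A T a)
  | .inl _ => inferInstanceAs (Finite Empty)
  | .inr o => inferInstanceAs (Finite (Fin (Sg.opArity o)))

open Classical in
/-- The evaluation of (not necessarily well-sorted) terms over `T`. -/
noncomputable def termValue : WType (TermArity A T) → Option A.Elem
  | ⟨.inl t, _⟩ => some t.1
  | ⟨.inr o, x⟩ =>
    if h : ∀ i : Fin (Sg.opArity o), ∃ a, termValue (x i) = some ⟨Sg.opDom o i, a⟩ then
      some ⟨_, A.op o fun i => (h i).choose⟩
    else none

variable {A T}

lemma InClosure.exists_termValue {s : Sg.Sorts} {a : A.carrier s} (ha : InClosure A T s a) :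
    ∃ t, termValue A T t = some ⟨s, a⟩ := by
  induction ha with
  | base h => exact ⟨⟨.inl ⟨_, h⟩, Empty.elim⟩, by rw [termValue]⟩
  | op o x _ ih =>
    choose t ht using ih
    have h (i : Fin (Sg.opArity o)) : ∃ a, termValue A T (t i) = some ⟨Sg.opDom o i, a⟩ :=
      ⟨x i, ht i⟩
    have e : (fun i => (h i).choose) = x := funext fun i => by
      have := (h i).choose_spec.symm.trans (ht i)
      simpa using this
    exact ⟨⟨.inr o, t⟩, by rw [termValue, dif_pos h, e]⟩

/-- Choosing a term for each element injects the structure into a type of finitely branching trees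
labelled by `T ⊕ Sg.Ops`. -/
lemma Generates.card_le (h : Generates A T) :
    A.card ≤ max (Cardinal.mk T + Cardinal.mk Sg.Ops) Cardinal.aleph0 := by
  choose t ht using fun x : A.Elem => (h x.1 x.2).exists_termValue
  have ht' : Function.Injective t := fun x y e => by
    have := (ht x).symm.trans ((congrArg _ e).trans (ht y))
    simpa using this
  refine (Cardinal.mk_le_of_injective ht').trans ?_
  simpa using WType.cardinalMk_le_max_aleph0_of_finite' (β := TermArity A T)

end Cardinality

/-- The property of being generated by fewer than `κ` elements. -/
def isGenerated (Sg : Signature.{w}) (κ : Cardinal.{w}) : ObjectProperty (Emb Sg) :=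
  fun A => ∃ T : Set A.Elem, Cardinal.mk T < κ ∧ Generates A T

lemma isGenerated_of_card_lt {A : Emb Sg} {κ : Cardinal.{w}} (h : A.card < κ) :
    isGenerated Sg κ A :=
  ⟨Set.univ, by rwa [Cardinal.mk_univ], A.generates_univ⟩

lemma isGenerated_closure (A : Emb Sg) {T : Set A.Elem} {κ : Cardinal.{w}}
    (h : Cardinal.mk T < κ) : isGenerated Sg κ (A.closure T) :=
  ⟨_, (mk_preimage_elemMap_le _ T).trans_lt h, A.generates_closure T⟩

/-- The structures of bounded cardinality form an essentially small class. -/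
lemma essentiallySmall_card_le (Sg : Signature.{w}) (μ : Cardinal.{w}) :
    ObjectProperty.EssentiallySmall.{w} (fun A : Emb Sg => A.card ≤ μ) where
  exists_small_le' := by
    -- Structures whose carriers are subsets of one fixed set of size `μ` form a small family
    -- meeting every isomorphism class in question.
    let I := Σ c : Sg.Sorts → Set μ.out,
      (∀ f : Sg.Ops, (∀ i : Fin (Sg.opArity f), c (Sg.opDom f i)) → c (Sg.opCod f)) ×
      (∀ R : Sg.Rels, (∀ i : Fin (Sg.relArity R), c (Sg.relDom R i)) → Prop)
    let X (i : I) : Emb Sg := ⟨fun s => i.1 s, i.2.1, i.2.2⟩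
    refine ⟨.ofObj X, inferInstance, fun A hA => ?_⟩
    obtain ⟨e⟩ : Nonempty (A.Elem ↪ μ.out) := by
      rw [← Cardinal.le_def, Cardinal.mk_out]
      exact hA
    let e' (s : Sg.Sorts) : A.carrier s ≃ Set.range fun a => e ⟨s, a⟩ :=
      Equiv.ofInjective _ (e.injective.comp sigma_mk_injective)
    let i : I := ⟨fun s => Set.range fun a => e ⟨s, a⟩,
      (A.transport e').op, (A.transport e').rel⟩
    exact ⟨X i, ObjectProperty.ofObj_apply X i, ⟨A.transportIso e'⟩⟩

lemma essentiallySmall_isGenerated (Sg : Signature.{w}) (κ : Cardinal.{w}) :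
    ObjectProperty.EssentiallySmall.{w} (isGenerated Sg κ) :=
  have := essentiallySmall_card_le Sg (max (κ + Cardinal.mk Sg.Ops) Cardinal.aleph0)
  .of_le fun _ ⟨_, hT, h⟩ =>
    h.card_le.trans (max_le_max_right _ (add_le_add_left hT.le _))

end Emb

/-! ### Reduction of filtered colimits to directed ones. -/

section Filtered

variable {C : Type u₁} [Category.{v₁} C] {D : Type u₂} [Category.{v₂} D]

lemma HasDirectedColimits.hasColimitsOfShape (h : HasDirectedColimits.{w} C) (J : Type w)
    [SmallCategory J] [IsFiltered J] : HasColimitsOfShape J C := by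
  obtain ⟨α, _, _, _, F, _⟩ := IsFiltered.exists_directed J
  have := h α
  exact Functor.Final.hasColimitsOfShape_of_final F

lemma PreservesDirectedColimits.preservesColimitsOfShape {H : C ⥤ D}
    (h : PreservesDirectedColimits.{w} H) (J : Type w) [SmallCategory J] [IsFiltered J] :
    PreservesColimitsOfShape J H := by
  obtain ⟨α, _, _, _, F, _⟩ := IsFiltered.exists_directed J
  have := h α
  exact Functor.Final.preservesColimitsOfShape_of_final F H

end Filtered

/-! ### Presentations by structures and a criterion for accessibility. -/

/-- The functor `U` presents `C`, up to equivalence, as a nearly full and replete subcategory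
of `Emb(Sg)` that is closed under directed colimits. -/
structure IsPresentation {Sg : Signature.{w}} {C : Type u₁} [Category.{v₁} C]
    (U : C ⥤ Emb Sg) : Prop where
  faithful : U.Faithful
  fullOnIsos : FullOnIsos U
  nearlyFull : NearlyFull U
  hasDirectedColimits : HasDirectedColimits.{w} C
  preservesDirectedColimits : PreservesDirectedColimits.{w} U

lemma Emb.isPresentation_id (Sg : Signature.{w}) : IsPresentation (𝟭 (Emb Sg)) where
  faithful := inferInstance
  fullOnIsos _ _ f := ⟨f, by ext; rfl⟩
  nearlyFull _ _ _ _ _ f _ := ⟨f, rfl⟩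
  hasDirectedColimits := Emb.hasDirectedColimits
  preservesDirectedColimits _ _ _ _ := inferInstance

namespace IsPresentation

variable {Sg : Signature.{w}} {C : Type u₁} [Category.{v₁} C] {U : C ⥤ Emb Sg}
  (hU : IsPresentation U)

include hU

lemma mono (X Y : C) (f : X ⟶ Y) : Mono f :=
  have := hU.faithful
  U.mono_of_mono_map inferInstance

lemma isIso_of_isIso_map {X Y : C} (f : X ⟶ Y) [IsIso (U.map f)] : IsIso f := by
  have := hU.faithful
  obtain ⟨e, he⟩ := hU.fullOnIsos X Y (asIso (U.map f))
  obtain rfl : e.hom = f := U.map_injective (congrArg Iso.hom he)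
  infer_instance

section Colimits

variable {J : Type w} [SmallCategory J] [IsFiltered J] {D : J ⥤ C} {c : Cocone D}

lemma jointlySurjective (hc : IsColimit c) : Emb.JointlySurjective (U.mapCocone c) :=
  have := hU.preservesDirectedColimits.preservesColimitsOfShape J
  Emb.jointlySurjective_of_isColimit (isColimitOfPreserves U hc)

/-- The comparison map from the actual colimit becomes an isomorphism under `U`, since both image
cocones are colimits, and `U` reflects isomorphisms. -/
lemma nonempty_isColimit (hc : Emb.JointlySurjective (U.mapCocone c)) :
    Nonempty (IsColimit c) := by
  have := hU.hasDirectedColimits.hasColimitsOfShape J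
  have := hU.preservesDirectedColimits.preservesColimitsOfShape J
  obtain ⟨h₂⟩ := hc.nonempty_isColimit
  let h₁ := isColimitOfPreserves U (colimit.isColimit D)
  have e : U.map ((colimit.isColimit D).desc c) = (h₁.coconePointUniqueUpToIso h₂).hom :=
    h₁.hom_ext fun j => by
      rw [IsColimit.comp_coconePointUniqueUpToIso_hom]
      change U.map _ ≫ U.map _ = U.map _
      rw [← U.map_comp, IsColimit.fac]
  have : IsIso (U.map ((colimit.isColimit D).desc c)) := by
    rw [e]
    infer_instance
  have := hU.isIso_of_isIso_map ((colimit.isColimit D).desc c)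
  exact ⟨(colimit.isColimit D).ofPointIso⟩

end Colimits

lemma exists_lift {X Y B : C} (f : X ⟶ B) (g : Y ⟶ B)
    (h : Emb.range (U.map f) ⊆ Emb.range (U.map g)) : ∃ k : X ⟶ Y, k ≫ g = f := by
  have := hU.faithful
  obtain ⟨k, hk⟩ := Emb.exists_lift _ _ h
  obtain ⟨k, rfl⟩ := hU.nearlyFull _ _ _ _ _ k hk
  exact ⟨k, U.map_injective (by rw [U.map_comp, hk])⟩

/-- The images of fewer than `κ` generators lie in a single stage, and then so does the image of all
of `X`. The factorization through that stage is unique because the legs are monomorphisms. -/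
lemma isCardinalPresentable (κ : Cardinal.{w}) [Fact κ.IsRegular] {X : C}
    (hX : Emb.isGenerated Sg κ (U.obj X)) : IsCardinalPresentable X κ where
  preservesColimitOfShape J _ _ :=
    { preservesColimit {D} :=
        { preserves {c} hc := ⟨by
            have := isFiltered_of_isCardinalFiltered J κ
            have mono := hU.mono
            refine Types.FilteredColimit.isColimitOf' _ _ (fun f => ?_) (fun i x y h => ?_)
            · obtain ⟨T, hT, hT'⟩ := hX
              obtain ⟨j, hj⟩ := (hU.jointlySurjective hc).exists_forall_mem κ
                ((hasCardinalLT_iff_cardinal_mk_lt T κ).2 hT)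
                (fun t => Emb.elemMap (U.map f) t)
              obtain ⟨k, hk⟩ := hU.exists_lift f (c.ι.app j)
                (hT'.range_subset _ _ fun x hx => hj ⟨x, hx⟩)
              exact ⟨j, k, hk.symm⟩
            · have h : x ≫ c.ι.app i = y ≫ c.ι.app i := h
              rw [cancel_mono] at h
              exact ⟨i, 𝟙 i, by rw [h]⟩⟩ } }

/-- Fullness on isomorphisms means that one object of `C` per isomorphism class of structures
suffices. -/
lemma essentiallySmall_isGenerated (κ : Cardinal.{w}) :
    ObjectProperty.EssentiallySmall.{w} ((Emb.isGenerated Sg κ).inverseImage U) := by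
  have := Emb.essentiallySmall_isGenerated Sg κ
  obtain ⟨Q, _, -, hQ⟩ := ObjectProperty.EssentiallySmall.exists_small_le.{w}
    (Emb.isGenerated Sg κ)
  let I := {A : Subtype Q // ∃ X : C, Nonempty (U.obj X ≅ A.1)}
  refine ⟨.ofObj fun i : I => i.2.choose, inferInstance, fun X hX => ?_⟩
  obtain ⟨A, hA, ⟨e⟩⟩ := hQ _ hX
  let i : I := ⟨⟨A, hA⟩, X, ⟨e⟩⟩
  obtain ⟨e', -⟩ := hU.fullOnIsos _ _ (e ≪≫ i.2.choose_spec.some.symm)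
  exact ⟨i.2.choose, ObjectProperty.ofObj_apply _ i, ⟨e'⟩⟩

/-- If any fewer than `κ` elements of an object are contained in a subobject generated by
fewer than `κ` elements, then the category is `κ`-accessible. -/
theorem isCardinalAccessibleCategory (κ : Cardinal.{w}) [hκ : Fact κ.IsRegular]
    (h : ∀ (B : C) (T : Set (U.obj B).Elem), Cardinal.mk T < κ →
      ∃ (X : C) (f : X ⟶ B), Emb.isGenerated Sg κ (U.obj X) ∧ T ⊆ Emb.range (U.map f)) :
    IsCardinalAccessibleCategory C κ := by
  have := hU.faithful
  have mono := hU.mono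
  have := hU.essentiallySmall_isGenerated κ
  have : LocallySmall.{w} C := locallySmall_of_faithful U
  have gen : ((Emb.isGenerated Sg κ).inverseImage U).IsCardinalFilteredGenerator κ :=
    { le_isCardinalPresentable := fun X hX => hU.isCardinalPresentable κ hX
      exists_colimitsOfShape := fun B => by
        -- Indexing by images rather than by pairs `(X, f)` gives a poset in the universe `w`;
        -- inclusions of images lift to unique transition maps.
        let J := {Z : Set (U.obj B).Elem // ∃ (X : C) (f : X ⟶ B),
          Emb.isGenerated Sg κ (U.obj X) ∧ Z = Emb.range (U.map f)}
        choose X f hX hf using fun Z : J => Z.2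
        have hlift {Z Z' : J} (hZ : Z ≤ Z') : ∃ k : X Z ⟶ X Z', k ≫ f Z' = f Z :=
          hU.exists_lift _ _ (by rw [← hf, ← hf]; exact hZ)
        choose k hk using @hlift
        let D : J ⥤ C :=
          { obj := X
            map := fun u => k (leOfHom u)
            map_id := fun Z => by rw [← cancel_mono (f Z), hk, Category.id_comp]
            map_comp := fun u v => by
              rw [← cancel_mono (f _), Category.assoc, hk, hk, hk] }
        let c : Cocone D :=
          { pt := B
            ι := { app := f, naturality := fun Z Z' u => (hk _).trans (Category.comp_id _).symm } }
        have hJ : IsCardinalFiltered J κ := isCardinalFiltered_preorder J κ fun K Z hK => by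
          choose T hT hT' using fun i => hX (Z i)
          -- By regularity of `κ` the generators of fewer than `κ` subobjects still number fewer
          -- than `κ`, so one subobject contains them all.
          have hT'' : Cardinal.mk (⋃ i, Emb.elemMap (U.map (f (Z i))) '' T i) < κ := by
            rw [← hasCardinalLT_iff_cardinal_mk_lt] at hK ⊢
            refine hasCardinalLT_iUnion _ hK fun i => ?_
            rw [hasCardinalLT_iff_cardinal_mk_lt]
            exact Cardinal.mk_image_le.trans_lt (hT i)
          obtain ⟨Y, g, hY, hg⟩ := h B _ hT''
          refine ⟨⟨Emb.range (U.map g), Y, g, hY, rfl⟩, fun i => ?_⟩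
          change (Z i).1 ⊆ Emb.range (U.map g)
          rw [hf]
          exact (hT' i).range_subset _ _ fun x hx =>
            hg (Set.mem_iUnion.2 ⟨i, Set.mem_image_of_mem _ hx⟩)
        have := isFiltered_of_isCardinalFiltered J κ
        have hc : Emb.JointlySurjective (U.mapCocone c) := fun x => by
          obtain ⟨Y, g, hY, hg⟩ := h B {x} (by
            rw [Cardinal.mk_singleton]
            exact Cardinal.one_lt_aleph0.trans_le hκ.out.aleph0_le)
          let Z : J := ⟨Emb.range (U.map g), Y, g, hY, rfl⟩
          refine ⟨Z, ?_⟩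
          change x ∈ Emb.range (U.map (f Z))
          rw [← hf]
          exact hg rfl
        obtain ⟨hc⟩ := hU.nonempty_isColimit hc
        exact ⟨J, inferInstance, hJ, ⟨{
          diag := D
          ι := c.ι
          isColimit := hc
          prop_diag_obj := hX }⟩⟩ }
  exact
    { toHasCardinalFilteredGenerator := gen.hasCardinalFilteredGenerator
      hasColimitsOfShape := fun J _ _ =>
        have := isFiltered_of_isCardinalFiltered J κ
        hU.hasDirectedColimits.hasColimitsOfShape J }

end IsPresentation

/-- The category of structures and embeddings is finitely accessible. -/
theorem Emb.isFinitelyAccessibleCategory (Sg : Signature.{w}) :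
    IsFinitelyAccessibleCategory.{w} (Emb Sg) :=
  have := Cardinal.fact_isRegular_aleph0
  (Emb.isPresentation_id Sg).isCardinalAccessibleCategory _ fun B T hT =>
    ⟨B.closure T, B.closureι T, B.isGenerated_closure hT, B.subset_range_closureι T⟩

/-! ### Abstract elementary classes are accessible -/

lemma Subcat.incl_faithful {C : Type u} [Category.{v} C] (S : Subcat C) : S.incl.Faithful where
  map_injective h := Subtype.ext h

namespace IsAEC

variable {Sg : Signature.{w}} {S : Subcat (Emb Sg)} (hS : IsAEC S)

include hS

/-- Repleteness follows from closure under colimits: an isomorphism is a colimit cocone over the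
one-point diagram at its source. -/
lemma hom_iso {X Y : Emb Sg} (hX : S.obj X) (e : X ≅ Y) : S.hom e.hom := by
  let D : PUnit.{w + 1} ⥤ S.Obj := (Functor.const _).obj ⟨X, hX⟩
  let c : Cocone (D ⋙ S.incl) :=
    { pt := Y
      ι :=
        { app := fun _ => e.hom
          naturality := fun _ _ _ =>
            (Category.id_comp e.hom).trans (Category.comp_id e.hom).symm } }
  have hc : Emb.JointlySurjective c := fun y => ⟨PUnit.unit, Emb.ap e.inv _ y.2, by
    change Emb.ap e.hom _ _ = _
    rw [← Emb.ap_comp, e.inv_hom_id, Emb.ap_id]⟩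
  obtain ⟨hc⟩ := hc.nonempty_isColimit
  exact (hS.closed _ D c hc).2.1 PUnit.unit

lemma fullOnIsos : FullOnIsos S.incl := fun X Y f =>
  ⟨{ hom := ⟨f.hom, hS.hom_iso X.property f⟩
     inv := ⟨f.inv, hS.hom_iso Y.property f.symm⟩
     hom_inv_id := Subtype.ext f.hom_inv_id
     inv_hom_id := Subtype.ext f.inv_hom_id }, by ext; rfl⟩

section Colimits

variable {I : Type w} [PartialOrder I] [IsDirectedOrder I] [Nonempty I] (D : I ⥤ S.Obj)

lemma exists_isColimit : ∃ c : Cocone D, Nonempty (IsColimit c) ∧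
    Nonempty (IsColimit (S.incl.mapCocone c)) := by
  let c := colimit.cocone (D ⋙ S.incl)
  let hc : IsColimit c := colimit.isColimit _
  obtain ⟨h₁, h₂, h₃⟩ := hS.closed I D c hc
  let c' : Cocone D :=
    { pt := ⟨c.pt, h₁⟩
      ι :=
        { app := fun i => ⟨c.ι.app i, h₂ i⟩
          naturality := fun _ _ u => Subtype.ext (c.ι.naturality u) } }
  exact ⟨c', ⟨{
    desc := fun s => ⟨hc.desc (S.incl.mapCocone s), h₃ s⟩
    fac := fun s i => Subtype.ext (hc.fac (S.incl.mapCocone s) i)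
    uniq := fun s m hm => Subtype.ext (hc.uniq (S.incl.mapCocone s) m.1
      fun i => congrArg Subtype.val (hm i)) }⟩, ⟨hc⟩⟩

end Colimits

lemma isPresentation : IsPresentation S.incl where
  faithful := S.incl_faithful
  fullOnIsos := hS.fullOnIsos
  nearlyFull := hS.nearlyFull
  hasDirectedColimits I _ _ _ :=
    ⟨fun D => by
      obtain ⟨c, ⟨hc⟩, -⟩ := hS.exists_isColimit D
      exact ⟨⟨c, hc⟩⟩⟩
  preservesDirectedColimits I _ _ _ :=
    ⟨fun {D} => by
      obtain ⟨c, ⟨hc⟩, ⟨hc'⟩⟩ := hS.exists_isColimit D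
      exact preservesColimit_of_preserves_colimit_cocone hc hc'⟩

theorem isAccessibleCategory : IsAccessibleCategory.{w} S.Obj := by
  obtain ⟨lam, hlam⟩ := hS.lowenheimSkolem
  -- `μ` absorbs both the Löwenheim–Skolem number and the number of terms over at most `μ` elements;
  -- passing to its successor gives a regular cardinal.
  let μ := max lam (max (Cardinal.mk Sg.Ops) Cardinal.aleph0)
  have hμ : Cardinal.aleph0 ≤ μ := (le_max_right _ _).trans (le_max_right _ _)
  have hκ : Fact (Order.succ μ).IsRegular := ⟨Cardinal.isRegular_succ hμ⟩
  refine ⟨Order.succ μ, hκ, hS.isPresentation.isCardinalAccessibleCategory _ fun B T hT => ?_⟩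
  rw [Order.lt_succ_iff] at hT
  obtain ⟨A, h, k, hh, hk, hA⟩ := hlam _ _ (B.val.closureι T) B.property
  refine ⟨⟨A, S.source_mem hh⟩, ⟨h, hh⟩, Emb.isGenerated_of_card_lt ?_, ?_⟩
  · rw [Order.lt_succ_iff]
    have hcard : (B.val.closure T).card ≤ μ :=
      (B.val.generates_closure T).card_le.trans (max_le (Cardinal.add_le_of_le hμ
        ((Emb.mk_preimage_elemMap_le _ T).trans hT)
          ((le_max_left _ _).trans (le_max_right _ _))) hμ)
    exact hA.trans (Cardinal.add_le_of_le hμ hcard (le_max_left _ _))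
  · refine (B.val.subset_range_closureι T).trans ?_
    rw [← hk]
    exact Emb.range_comp_subset k h

end IsAEC

lemma IsPresentation.comp_equivalence {Sg : Signature.{w}} {C : Type u₁} [Category.{v₁} C]
    {D : Type u₂} [Category.{v₂} D] {U : D ⥤ Emb Sg} (hU : IsPresentation U) (e : C ≌ D) :
    IsPresentation (e.functor ⋙ U) where
  faithful :=
    have := hU.faithful
    inferInstance
  fullOnIsos A B f := by
    obtain ⟨g, hg⟩ := hU.fullOnIsos _ _ f
    refine ⟨e.functor.preimageIso g, ?_⟩
    rw [← hg]
    ext1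
    simp
  nearlyFull A B E h g f hf := by
    obtain ⟨k, hk⟩ := hU.nearlyFull _ _ _ _ _ f hf
    exact ⟨e.functor.preimage k, by simp [hk]⟩
  hasDirectedColimits I _ _ _ :=
    have := hU.hasDirectedColimits I
    Adjunction.hasColimitsOfShape_of_equivalence e.functor
  preservesDirectedColimits I _ _ _ :=
    have := hU.preservesDirectedColimits I
    inferInstance

/-! ### Making a functor injective on objects -/

section Replacement

variable {K : Type u₁} [Category.{v₁} K] {L : Type u₂} [Category.{v₂} L] (H : K ⥤ L)

/-- A category equivalent to `L` whose objects include those of `K`. -/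
abbrev Replacement : Type (max u₁ u₂) := InducedCategory L (Sum.elim H.obj id : K ⊕ L → L)

/-- The functor to the replacement of the target that is injective on objects. -/
def toReplacement : K ⥤ Replacement H where
  obj X := (Sum.inl X : K ⊕ L)
  map f := InducedCategory.homMk (H.map f)
  map_id X := InducedCategory.hom_ext (H.map_id X)
  map_comp f g := InducedCategory.hom_ext (H.map_comp f g)

/-- The projection from the replacement of the target of `H`. -/
abbrev replacementProj : Replacement H ⥤ L := inducedFunctor _

instance : (replacementProj H).EssSurj where
  mem_essImage X := ⟨(Sum.inr X : K ⊕ L), ⟨Iso.refl X⟩⟩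

instance : (replacementProj H).IsEquivalence where

lemma toReplacement_injective : Function.Injective (toReplacement H).obj :=
  fun _ _ h => Sum.inl_injective h

lemma toReplacement_faithful [H.Faithful] : (toReplacement H).Faithful where
  map_injective h := H.map_injective (congrArg (replacementProj H).map h)

variable {H}

lemma FullOnIsos.toReplacement (h : FullOnIsos H) : FullOnIsos (toReplacement H) := fun A B f => by
  obtain ⟨g, hg⟩ := h A B ((replacementProj H).mapIso f)
  exact ⟨g, Iso.ext (InducedCategory.hom_ext (congrArg Iso.hom hg))⟩

lemma NearlyFull.toReplacement (h : NearlyFull H) : NearlyFull (toReplacement H) :=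
  fun A B E k g f hf => by
    obtain ⟨g, hg⟩ := h A B E k g f.hom (congrArg (replacementProj H).map hf)
    exact ⟨g, InducedCategory.hom_ext hg⟩

lemma PreservesDirectedColimits.toReplacement (h : PreservesDirectedColimits.{w} H) :
    PreservesDirectedColimits.{w} (toReplacement H) := fun I _ _ _ =>
  -- This composite is `H` by definition, and the projection, an equivalence, reflects colimits.
  have : PreservesColimitsOfShape I (AEC.toReplacement H ⋙ replacementProj H) := h I
  preservesColimitsOfShape_of_reflects_of_preserves _ (replacementProj H)

end Replacement

theorem EquivalentToAEC.exists_embedding {K : Type u} [Category.{v} K]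
    (h : EquivalentToAEC.{w} K) :
    IsAccessibleCategory.{w} K ∧ HasDirectedColimits.{w} K ∧
      (∀ (X Y : K) (f : X ⟶ Y), Mono f) ∧
      ∃ (L : Type (max u (w + 1))) (_ : Category.{w} L) (H : K ⥤ L),
        IsFinitelyAccessibleCategory.{w} L ∧
        H.Faithful ∧ Function.Injective H.obj ∧
        FullOnIsos H ∧ NearlyFull H ∧
        PreservesDirectedColimits.{w} H ∧ H.PreservesMonomorphisms := by
  obtain ⟨Sg, S, hS, ⟨e⟩⟩ := h
  have hU := hS.isPresentation.comp_equivalence e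
  have := hS.isAccessibleCategory
  have := hU.faithful
  have := Cardinal.fact_isRegular_aleph0
  have := Emb.isFinitelyAccessibleCategory Sg
  let H := e.functor ⋙ S.incl
  refine ⟨e.symm.isAccessibleCategory, hU.hasDirectedColimits, hU.mono, Replacement H,
    inferInstance, toReplacement H,
    (replacementProj H).asEquivalence.symm.isCardinalAccessibleCategory Cardinal.aleph0,
    toReplacement_faithful H, toReplacement_injective H, hU.fullOnIsos.toReplacement,
    hU.nearlyFull.toReplacement, hU.preservesDirectedColimits.toReplacement,
    ⟨fun f _ => (replacementProj H).mono_of_mono_map inferInstance⟩⟩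

/-! ### From a presentation to an abstract elementary class. -/

/-- A map to a directed poset is dominated by a monotone map from the finite subsets of its
source. -/
lemma exists_monotone_finset {α : Type u₁} [PartialOrder α] [IsDirectedOrder α] [Nonempty α]
    {T : Type u₂} (t : T → α) : ∃ φ : Finset T → α, Monotone φ ∧ ∀ x, t x ≤ φ {x} := by
  classical
  -- One step of a recursion along strict inclusion: the value at `s` must dominate `t` on `s` and
  -- the finitely many values already assigned to strict subsets.
  have ub (s : Finset T) (ψ : ∀ r : Finset T, r ⊂ s → α) :
      ∃ a, (∀ x ∈ s, t x ≤ a) ∧ ∀ r (h : r ⊂ s), ψ r h ≤ a := by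
    let ψ' (r : {r // r ∈ s.ssubsets}) : α := ψ r.1 (Finset.mem_ssubsets.1 r.2)
    obtain ⟨a, ha⟩ := Finset.exists_le (s.image t ∪ s.ssubsets.attach.image ψ')
    refine ⟨a, fun x hx => ha _ (Finset.mem_union_left _ (Finset.mem_image_of_mem t hx)),
      fun r h => ha _ (Finset.mem_union_right _ (Finset.mem_image.2
        ⟨⟨r, Finset.mem_ssubsets.2 h⟩, Finset.mem_attach _ _, rfl⟩))⟩
  choose f hf₁ hf₂ using ub
  let φ : Finset T → α := Finset.strongInduction f
  have hφ (s : Finset T) : φ s = f s fun r _ => φ r := Finset.strongInduction_eq f s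
  refine ⟨φ, fun r s hrs => ?_, fun x => ?_⟩
  · obtain rfl | h := eq_or_ssubset_of_subset hrs
    · exact le_rfl
    · rw [hφ s]
      exact hf₂ s (fun r _ => φ r) r h
  · rw [hφ]
    exact hf₁ _ _ x (Finset.mem_singleton_self x)

lemma Emb.JointlySurjective.card_le {Sg : Signature.{w}} {J : Type w} [SmallCategory J]
    {F : J ⥤ Emb Sg} {c : Cocone F} (hc : JointlySurjective c) {μ : Cardinal.{w}}
    (hμ : ∀ j, (F.obj j).card ≤ μ) : c.pt.card ≤ Cardinal.mk J * μ := by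
  let p : (Σ j, (F.obj j).Elem) → c.pt.Elem := fun x => elemMap (B := c.pt) (c.ι.app x.1) x.2
  have hp : Function.Surjective p := by
    rintro ⟨s, x⟩
    obtain ⟨j, hj⟩ := hc ⟨s, x⟩
    obtain ⟨a, rfl⟩ := (mk_mem_range_iff _).1 hj
    exact ⟨⟨j, s, a⟩, rfl⟩
  refine (Cardinal.mk_le_of_surjective hp).trans ?_
  rw [Cardinal.mk_sigma]
  exact (Cardinal.sum_le_sum _ _ hμ).trans (Cardinal.sum_const' _ _).le

namespace IsPresentation

variable {Sg : Signature.{w}} {K : Type u₁} [Category.{v₁} K] {G : K ⥤ Emb Sg}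
  (hG : IsPresentation G)

/-- The replete image of a presentation. -/
def image : Subcat (Emb Sg) where
  obj X := ∃ A, Nonempty (G.obj A ≅ X)
  hom {X Y} f := ∃ (A B : K) (i : G.obj A ≅ X) (j : G.obj B ≅ Y) (g : A ⟶ B),
    i.hom ≫ f = G.map g ≫ j.hom
  source_mem := fun ⟨A, _, i, _⟩ => ⟨A, ⟨i⟩⟩
  target_mem := fun ⟨_, B, _, j, _⟩ => ⟨B, ⟨j⟩⟩
  id_mem := fun ⟨A, ⟨i⟩⟩ => ⟨A, A, i, i, 𝟙 A, by simp⟩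
  comp_mem := by
    rintro X Y Z f f' ⟨A, B, i, j, g, h⟩ ⟨B', C, i', j', g', h'⟩
    -- The two morphisms may witness the middle object by different objects of `K`; fullness on
    -- isomorphisms identifies these inside `K`.
    obtain ⟨e, he⟩ := hG.fullOnIsos _ _ (j ≪≫ i'.symm)
    have he' : G.map e.hom = j.hom ≫ i'.inv := congrArg Iso.hom he
    refine ⟨A, C, i, j', g ≫ e.hom ≫ g', ?_⟩
    simp [he', reassoc_of% h, ← h']

/-- Membership does not depend on the chosen witnesses, because isomorphisms between them lift to
`K`. -/
lemma image_hom_iff {A B : K} {X Y : Emb Sg} (i : G.obj A ≅ X) (j : G.obj B ≅ Y) (f : X ⟶ Y) :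
    hG.image.hom f ↔ ∃ g : A ⟶ B, i.hom ≫ f = G.map g ≫ j.hom := by
  refine ⟨?_, fun ⟨g, hg⟩ => ⟨A, B, i, j, g, hg⟩⟩
  rintro ⟨A', B', i', j', g, h⟩
  obtain ⟨a, ha⟩ := hG.fullOnIsos _ _ (i ≪≫ i'.symm)
  obtain ⟨b, hb⟩ := hG.fullOnIsos _ _ (j' ≪≫ j.symm)
  have ha' : G.map a.hom = i.hom ≫ i'.inv := congrArg Iso.hom ha
  have hb' : G.map b.hom = j'.hom ≫ j.inv := congrArg Iso.hom hb
  refine ⟨a.hom ≫ g ≫ b.hom, ?_⟩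
  simp [ha', hb', ← reassoc_of% h]

lemma image_hom_iso {X Y : Emb Sg} (hX : hG.image.obj X) (e : X ≅ Y) : hG.image.hom e.hom := by
  obtain ⟨A, ⟨i⟩⟩ := hX
  exact ⟨A, A, i, i ≪≫ e, 𝟙 A, by simp⟩

/-- The functor to the replete image. -/
def toImage : K ⥤ hG.image.Obj where
  obj A := ⟨G.obj A, A, ⟨Iso.refl _⟩⟩
  map f := ⟨G.map f, _, _, Iso.refl _, Iso.refl _, f, by simp⟩
  map_id A := Subtype.ext (G.map_id A)
  map_comp f g := Subtype.ext (G.map_comp f g)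

lemma toImage_isEquivalence : hG.toImage.IsEquivalence where
  faithful := ⟨fun h =>
    have := hG.faithful
    G.map_injective (congrArg Subtype.val h)⟩
  full := ⟨fun {A B} f => by
    obtain ⟨g, hg⟩ := (hG.image_hom_iff (Iso.refl (G.obj A)) (Iso.refl (G.obj B)) f.1).1 f.2
    exact ⟨g, Subtype.ext (((Category.comp_id (G.map g)).symm.trans hg.symm).trans
      (Category.id_comp f.1))⟩⟩
  essSurj := ⟨fun X => by
    obtain ⟨A, ⟨i⟩⟩ := X.property
    exact ⟨A, ⟨{
      hom := ⟨i.hom, hG.image_hom_iso ⟨A, ⟨Iso.refl _⟩⟩ i⟩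
      inv := ⟨i.inv, hG.image_hom_iso X.property i.symm⟩
      hom_inv_id := Subtype.ext i.hom_inv_id
      inv_hom_id := Subtype.ext i.inv_hom_id }⟩⟩⟩

lemma nearlyFull_image : NearlyFull hG.image.incl := fun X Y Z h g f hf => by
  obtain ⟨A, ⟨i⟩⟩ := X.property
  obtain ⟨B, ⟨j⟩⟩ := Y.property
  obtain ⟨C, ⟨k⟩⟩ := Z.property
  obtain ⟨h', hh'⟩ := (hG.image_hom_iff i k h.1).1 h.2
  obtain ⟨g', hg'⟩ := (hG.image_hom_iff j k g.1).1 g.2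
  obtain ⟨f, rfl⟩ : ∃ f' : X.val ⟶ Y.val, f' = f := ⟨f, rfl⟩
  have hf : f ≫ g.1 = h.1 := hf
  obtain ⟨f', hf'⟩ := hG.nearlyFull A B C h' g' (i.hom ≫ f ≫ j.inv) (by
    rw [← cancel_mono k.hom, ← hh', Category.assoc, ← hg', ← hf]
    simp)
  exact ⟨⟨f, (hG.image_hom_iff i j f).2 ⟨f', by rw [hf']; simp⟩⟩, rfl⟩

lemma closedUnderDirectedColimits_image :
    Subcat.ClosedUnderDirectedColimits.{w} hG.image := fun I _ _ _ D c hc => by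
  have := hG.toImage_isEquivalence
  have := hG.hasDirectedColimits I
  have : HasColimitsOfShape I hG.image.Obj :=
    Adjunction.hasColimitsOfShape_of_equivalence hG.toImage.inv
  have : PreservesColimitsOfShape I hG.image.incl := by
    have := hG.preservesDirectedColimits I
    let e : hG.toImage.inv ⋙ G ≅ hG.image.incl :=
      Functor.isoWhiskerRight hG.toImage.asEquivalence.counitIso hG.image.incl
    exact preservesColimitsOfShape_of_natIso e
  -- The given cocone is isomorphic to the image of a colimit formed inside the subcategory, and
  -- that isomorphism belongs to the subcategory by repleteness.
  let h₀ := isColimitOfPreserves hG.image.incl (colimit.isColimit D)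
  let φ := h₀.coconePointUniqueUpToIso hc
  have hφ : hG.image.hom φ.hom := hG.image_hom_iso (colimit D).property φ
  refine ⟨hG.image.target_mem hφ, fun i => ?_, fun s => ?_⟩
  · have e : (colimit.ι D i).1 ≫ φ.hom = c.ι.app i :=
      h₀.comp_coconePointUniqueUpToIso_hom hc i
    rw [← e]
    exact hG.image.comp_mem (colimit.ι D i).2 hφ
  · have e : φ.inv ≫ hG.image.incl.map (colimit.desc D s) =
        hc.desc (hG.image.incl.mapCocone s) :=
      hc.hom_ext fun i => by
        rw [hc.fac]
        refine (h₀.comp_coconePointUniqueUpToIso_inv_assoc hc i _).trans ?_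
        exact congrArg Subtype.val (colimit.ι_desc s i)
    rw [← e]
    exact hG.image.comp_mem (hG.image_hom_iso (hG.image.target_mem hφ) φ.symm)
      (colimit.desc D s).2

include hG in
/-- In an accessible category with directed colimits, any set of elements of an object is
contained in a subobject of controlled cardinality. -/
lemma exists_card_le [IsAccessibleCategory.{w} K] :
    ∃ lam : Cardinal.{w}, ∀ (B : K) {T : Type w} (x : T → (G.obj B).Elem),
      ∃ (X : K) (f : X ⟶ B), (∀ t, x t ∈ Emb.range (G.map f)) ∧
        (G.obj X).card ≤ Cardinal.mk T + lam := by
  obtain ⟨κ, _, _⟩ := IsAccessibleCategory.exists_cardinal.{w} K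
  obtain ⟨P, _, hP⟩ := HasCardinalFilteredGenerator.exists_small_generator K κ
  let μ : Cardinal.{w} := ⨆ i : Shrink.{w} (Subtype P),
    (G.obj ((equivShrink (Subtype P)).symm i).1).card
  have hμ (X : K) (hX : P X) : (G.obj X).card ≤ μ := by
    have := le_ciSup (Cardinal.bddAbove_of_small (s := Set.range fun i : Shrink.{w} (Subtype P) =>
      (G.obj ((equivShrink (Subtype P)).symm i).1).card)) (equivShrink (Subtype P) ⟨X, hX⟩)
    simpa using this
  refine ⟨max Cardinal.aleph0 μ, fun B T x => ?_⟩
  obtain ⟨J, _, _, ⟨p⟩⟩ := hP.exists_colimitsOfShape B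
  obtain ⟨α, _, _, F, _⟩ := IsCardinalFiltered.exists_cardinal_directed J κ
  have := isFiltered_of_isCardinalFiltered α κ
  have : IsDirectedOrder α := ⟨fun a b =>
    ⟨IsFiltered.max a b, leOfHom (IsFiltered.leftToMax a b), leOfHom (IsFiltered.rightToMax a b)⟩⟩
  have : Nonempty α := IsFiltered.nonempty
  let q := p.reindex F
  -- Each element appears at some index. A monotone map on finite subsets dominates these indices,
  -- so restricting along it keeps every element while using at most `|Finset T|` stages.
  choose t ht using fun y => hG.jointlySurjective q.isColimit (x y)
  obtain ⟨φ, hφ, hφt⟩ := exists_monotone_finset t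
  classical
  let D : Finset T ⥤ K := hφ.functor ⋙ q.diag
  have := hG.hasDirectedColimits (Finset T)
  let c : Cocone D := q.cocone.whisker hφ.functor
  refine ⟨colimit D, colimit.desc D c, fun y => ?_, ?_⟩
  · have h₁ := Emb.range_ι_subset (G.mapCocone q.cocone) (homOfLE (hφt y)) (ht y)
    have h₂ : G.map (q.ι.app (φ {y})) = G.map (colimit.ι D {y}) ≫ G.map (colimit.desc D c) := by
      rw [← G.map_comp, colimit.ι_desc]
      rfl
    change x y ∈ Emb.range (G.map (q.ι.app (φ {y}))) at h₁
    rw [h₂] at h₁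
    exact Emb.range_comp_subset _ _ h₁
  · have h₁ := (hG.jointlySurjective (colimit.isColimit D)).card_le (μ := μ)
      fun s => hμ _ (q.prop_diag_obj (φ s))
    have h₂ : Cardinal.mk (Finset T) ≤ Cardinal.mk T + max Cardinal.aleph0 μ := by
      -- For infinite `T`, `Finset T` has the size of `T`; for finite `T` it is countable and
      -- absorbed by the `ℵ₀` in the constant.
      obtain _ | _ := finite_or_infinite T
      · exact (Cardinal.mk_le_aleph0).trans ((le_max_left _ _).trans le_add_self)
      · rw [Cardinal.mk_finset_of_infinite]
        exact le_self_add
    refine h₁.trans (Cardinal.mul_le_of_le ?_ h₂ ?_)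
    · exact (le_max_left _ _).trans le_add_self
    · exact (le_max_right _ _).trans le_add_self

theorem isAEC_image [IsAccessibleCategory.{w} K] : IsAEC hG.image where
  nearlyFull := hG.nearlyFull_image
  closed := hG.closedUnderDirectedColimits_image
  lowenheimSkolem := by
    obtain ⟨lam, hlam⟩ := hG.exists_card_le
    refine ⟨lam, fun A B f ⟨B₀, ⟨i⟩⟩ => ?_⟩
    -- The elements to be covered are indexed by the underlying set of `A` itself, so the bound is
    -- `A.card + lam`.
    obtain ⟨X, g, hg, hX⟩ := hlam B₀ (Emb.elemMap (f ≫ i.inv))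
    obtain ⟨k, hk⟩ := Emb.exists_lift (f ≫ i.inv) (G.map g)
      (A.generates_univ.range_subset _ _ fun x _ => hg x)
    exact ⟨G.obj X, G.map g ≫ i.hom, k, ⟨X, B₀, Iso.refl _, i, g, by simp⟩,
      by rw [reassoc_of% hk]; simp, hX⟩

include hG in
theorem equivalentToAEC [IsAccessibleCategory.{w} K] : EquivalentToAEC.{w} K :=
  have := hG.toImage_isEquivalence
  ⟨Sg, hG.image, hG.isAEC_image, ⟨hG.toImage.asEquivalence⟩⟩

end IsPresentation

/-! ### Presheaves as structures -/

/-- The signature of presheaves on `A`: the sorts are the objects of `A`, and the operations are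
unary and given by the morphisms of `A`. -/
def presheafSignature (A : Type w) [SmallCategory A] : Signature.{w} where
  Sorts := A
  Ops := Σ p : A × A, p.1 ⟶ p.2
  opArity _ := 1
  opDom f _ := f.1.2
  opCod f := f.1.1
  Rels := PEmpty
  relArity := PEmpty.elim
  relDom R := R.elim

section Nerve

variable {A : Type w} [SmallCategory A] {L : Type u₂} [Category.{w} L] (F : A ⥤ L)

/-- The presheaf `Hom(F -, X)` as a structure. -/
def nerve (X : L) : Emb (presheafSignature A) where
  carrier a := F.obj a ⟶ X
  op f x := F.map f.2 ≫ x (0 : Fin 1)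
  rel R _ := R.elim

/-- The embedding of structures induced by a monomorphism. -/
def nerveMap {X Y : L} (g : X ⟶ Y) [Mono g] : nerve F X ⟶ nerve F Y where
  toFun _ x := x ≫ g
  injective _ _ _ h := (cancel_mono g).1 h
  map_op _ _ := Category.assoc _ _ _
  map_rel R := R.elim

variable {F}

lemma nerve_naturality {X Y : L} (f : nerve F X ⟶ nerve F Y) {a b : A} (φ : a ⟶ b)
    (x : F.obj b ⟶ X) :
    Emb.ap f a (F.map φ ≫ x : F.obj a ⟶ X) = F.map φ ≫ (Emb.ap f b x : F.obj b ⟶ Y) :=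
  Emb.ap_op f (⟨(a, b), φ⟩ : (presheafSignature A).Ops) fun _ => x

variable [F.IsDense]

lemma hom_ext_of_isDense {X Y : L} {f g : X ⟶ Y} (h : ∀ (a : A) (x : F.obj a ⟶ X), x ≫ f = x ≫ g) :
    f = g :=
  (F.denseAt X).hom_ext' fun a x => by
    change 𝟙 (F.obj a) ≫ x ≫ f = 𝟙 (F.obj a) ≫ x ≫ g
    rw [h]

/-- Compatibility with the unary operations is naturality, so `f` is a cocone on the canonical
diagram of `X`; density says that `X` is the colimit of this diagram. -/
lemma exists_hom_of_nerve {X Y : L} (f : nerve F X ⟶ nerve F Y) :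
    ∃ g : X ⟶ Y, ∀ (a : A) (x : F.obj a ⟶ X), x ≫ g = Emb.ap f a x := by
  let c : Cocone (CostructuredArrow.proj F X ⋙ F) :=
    { pt := Y
      ι :=
        { app := fun p => (Emb.ap f p.left p.hom : F.obj p.left ⟶ Y)
          naturality := fun p q φ => by
            have h := nerve_naturality f φ.left q.hom
            rw [CostructuredArrow.w φ] at h
            exact h.symm.trans (Category.comp_id _).symm } }
  refine ⟨(F.denseAt X).desc c, fun a x => ?_⟩
  have h : (𝟙 (F.obj a) ≫ x) ≫ (F.denseAt X).desc c = Emb.ap f a x :=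
    (F.denseAt X).fac c (CostructuredArrow.mk x)
  rwa [Category.id_comp] at h

end Nerve

section NerveFunctor

variable {A : Type w} [SmallCategory A] {L : Type u₂} [Category.{w} L] (F : A ⥤ L)
  {K : Type u₁} [Category.{v₁} K] (H : K ⥤ L) [hH : ∀ {X Y : K} (f : X ⟶ Y), Mono (H.map f)]

/-- The functor to structures induced by a functor that sends all morphisms to monomorphisms. -/
def nerveFunctor : K ⥤ Emb (presheafSignature A) where
  obj X := nerve F (H.obj X)
  map f := nerveMap F (H.map f)
  map_id X := Emb.hom_ext fun a x => by
    change x ≫ H.map (𝟙 X) = x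
    rw [H.map_id]
    exact Category.comp_id (X := F.obj a) x
  map_comp f g := Emb.hom_ext fun a x => by
    change x ≫ H.map (f ≫ g) = (x ≫ H.map f) ≫ H.map g
    rw [H.map_comp]
    exact (Category.assoc (W := F.obj a) x _ _).symm

-- By density, embeddings between nerves come from `L`, so faithfulness and both fullness conditions
-- are inherited from `H`. Directed colimits are preserved because a map from the finitely
-- presentable `F.obj a` into one factors through a stage, which is joint surjectivity.
attribute [local instance] Cardinal.fact_isRegular_aleph0 in
lemma isPresentation_nerveFunctor [F.IsDense]
    (hF : ∀ a, IsFinitelyPresentable.{w} (F.obj a)) (hK : HasDirectedColimits.{w} K)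
    [H.Faithful] (h₁ : FullOnIsos H) (h₂ : NearlyFull H) (h₃ : PreservesDirectedColimits.{w} H) :
    IsPresentation (nerveFunctor F H) where
  faithful := ⟨fun {X Y f g} h => H.map_injective (hom_ext_of_isDense (F := F) fun a x =>
    congrArg (fun k => Emb.ap k a x) h)⟩
  fullOnIsos X Y f := by
    obtain ⟨g, hg⟩ := exists_hom_of_nerve f.hom
    obtain ⟨g', hg'⟩ := exists_hom_of_nerve f.inv
    let e : H.obj X ≅ H.obj Y :=
      { hom := g
        inv := g'
        hom_inv_id := hom_ext_of_isDense (F := F) fun a x => by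
          rw [← Category.assoc, hg, Category.comp_id]
          refine (hg' a _).trans ?_
          exact congrArg (fun k => Emb.ap k a x) f.hom_inv_id
        inv_hom_id := hom_ext_of_isDense (F := F) fun a x => by
          rw [← Category.assoc, hg', Category.comp_id]
          refine (hg a _).trans ?_
          exact congrArg (fun k => Emb.ap k a x) f.inv_hom_id }
    obtain ⟨e', he'⟩ := h₁ X Y e
    refine ⟨e', Iso.ext (Emb.hom_ext fun a x => ?_)⟩
    refine Eq.trans ?_ (hg a x)
    exact congrArg (fun k => x ≫ k) (congrArg Iso.hom he')
  nearlyFull X Y Z h g f hf := by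
    obtain ⟨k, hk⟩ := exists_hom_of_nerve f
    obtain ⟨k', hk'⟩ := h₂ X Y Z h g k (hom_ext_of_isDense (F := F) fun a x => by
      rw [← Category.assoc, hk]
      exact congrArg (fun k => Emb.ap k a x) hf)
    refine ⟨k', Emb.hom_ext fun a x => ?_⟩
    refine Eq.trans ?_ (hk a x)
    exact congrArg (fun k => x ≫ k) hk'
  hasDirectedColimits := hK
  preservesDirectedColimits I _ _ _ := ⟨fun {D} => ⟨fun {c} hc => by
    have := h₃ I
    refine Emb.JointlySurjective.nonempty_isColimit ?_
    rintro ⟨a, x⟩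
    have := hF a
    obtain ⟨i, y, hy⟩ := IsFinitelyPresentable.exists_hom_of_isColimit
      (isColimitOfPreserves H hc) (X := F.obj a) x
    exact ⟨i, (Emb.mk_mem_range_iff _).2 ⟨y, hy⟩⟩⟩⟩

end NerveFunctor

theorem equivalentToAEC_of_functor {K : Type u} [Category.{v} K] [IsAccessibleCategory.{w} K]
    (hK : HasDirectedColimits.{w} K) (hK' : ∀ (X Y : K) (f : X ⟶ Y), Mono f)
    {L : Type u₂} [Category.{w} L] (hL : IsFinitelyAccessibleCategory.{w} L) (H : K ⥤ L)
    [H.Faithful] (h₁ : FullOnIsos H) (h₂ : NearlyFull H) (h₃ : PreservesDirectedColimits.{w} H)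
    [H.PreservesMonomorphisms] : EquivalentToAEC.{w} K := by
  have := Cardinal.fact_isRegular_aleph0
  let P := isCardinalPresentable L Cardinal.aleph0.{w}
  -- The sorts must form a type in the universe `w`, so the finitely presentable objects are
  -- replaced by a small model.
  let F : SmallModel.{w} P.FullSubcategory ⥤ L :=
    (equivSmallModel.{w} P.FullSubcategory).inverse ⋙ P.ι
  have : F.IsDense := inferInstance
  have {X Y : K} (f : X ⟶ Y) : Mono (H.map f) := inferInstance
  exact (isPresentation_nerveFunctor F H
    (fun a => ((equivSmallModel.{w} P.FullSubcategory).inverse.obj a).property)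
    hK h₁ h₂ h₃).equivalentToAEC

end AEC

/-- The second condition reads "embedding" strictly (faithful and injective on objects), the third
one only asks for a faithful functor. -/
theorem corollary5p7 (K : Type u) [Category.{v} K] :
    List.TFAE [
      AEC.EquivalentToAEC.{w} K,
      IsAccessibleCategory.{w} K ∧ AEC.HasDirectedColimits.{w} K ∧
        (∀ (X Y : K) (f : X ⟶ Y), Mono f) ∧
        ∃ (L : Type (max u (w + 1))) (_ : Category.{w} L) (H : K ⥤ L),
          IsFinitelyAccessibleCategory.{w} L ∧
          H.Faithful ∧ Function.Injective H.obj ∧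
          AEC.FullOnIsos H ∧ AEC.NearlyFull H ∧
          AEC.PreservesDirectedColimits.{w} H ∧ H.PreservesMonomorphisms,
      IsAccessibleCategory.{w} K ∧ AEC.HasDirectedColimits.{w} K ∧
        (∀ (X Y : K) (f : X ⟶ Y), Mono f) ∧
        ∃ (L : Type (max u (w + 1))) (_ : Category.{w} L) (H : K ⥤ L),
          IsFinitelyAccessibleCategory.{w} L ∧
          H.Faithful ∧
          AEC.FullOnIsos H ∧ AEC.NearlyFull H ∧
          AEC.PreservesDirectedColimits.{w} H ∧ H.PreservesMonomorphisms] := by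
  tfae_have 1 → 2 := AEC.EquivalentToAEC.exists_embedding
  tfae_have 2 → 3 := fun ⟨h₁, h₂, h₃, L, _, H, h₄, h₅, _, h₆⟩ =>
    ⟨h₁, h₂, h₃, L, _, H, h₄, h₅, h₆⟩
  tfae_have 3 → 1 := fun ⟨_, hK, hK', _, _, H, hL, _, h₁, h₂, h₃, _⟩ =>
    AEC.equivalentToAEC_of_functor hK hK' hL H h₁ h₂ h₃
  tfae_finish
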